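/- For $d>0$ and $n\ge 1$ let $\mathbf A=\mathbf A(n,p)$ be the random $n\times n$ matrix over $\mathbb F_2$ whose entries are independently equal to $1$ with probability $p=\min\{d/n,1\}$ and equal to $0$ otherwise. Given $\mathbf A$, let $\mathbf x=(\mathbf x_1,\ldots,\mathbf x_n)$ be a uniformly random element of $\ker\mathbf A=\{x\in\mathbb F_2^n:\mathbf Ax=0\}$. For every integer $\ell\ge 1$ there exists $\gamma>0$ such that for all $d>0$ and all $\sigma\in\mathbb F_2^\ell$, $$\lim_{n\to\infty}\mathbb E\left[n^{\gamma}\left|\mathbb P\left[\mathbf x_1=\sigma_1,\ldots,\mathbf x_\ell=\sigma_\ell\mid\mathbf A\right]-\prod_{i=1}^{\ell}\mathbb P\left[\mathbf x_i=\sigma_i\mid\mathbf A\right]\right|\right]=0,$$ where the limit is over $n\ge\ell$. -/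

import Mathlib

open Filter Topology

noncomputable section

namespace SparseParity

/-- The entry probability `p = (d / n) ∧ 1`. -/
def entryProb (d : ℝ) (n : ℕ) : ℝ := min (d / n) 1

/-- The probability that the random `n × n` matrix over `𝔽₂`, whose entries are independently
equal to `1` with probability `p = (d / n) ∧ 1` and to `0` otherwise, takes the value `A`. -/
def matrixProb (d : ℝ) (n : ℕ) (A : Matrix (Fin n) (Fin n) (ZMod 2)) : ℝ :=
  ∏ i, ∏ j, if A i j = 1 then entryProb d n else 1 - entryProb d n

/-- The expectation of `F 𝐀` over the random matrix `𝐀`. -/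
def expect (d : ℝ) (n : ℕ) (F : Matrix (Fin n) (Fin n) (ZMod 2) → ℝ) : ℝ :=
  ∑ A, matrixProb d n A * F A

/-- The probability that a uniformly random element `x` of `ker A` satisfies `P`. -/
def kerProb {n : ℕ} (A : Matrix (Fin n) (Fin n) (ZMod 2)) (P : (Fin n → ZMod 2) → Prop) : ℝ :=
  (Nat.card {x : LinearMap.ker A.mulVecLin // P x} : ℝ) / Nat.card (LinearMap.ker A.mulVecLin)

/-- For a uniformly random `x ∈ ker A`, the absolute difference between the probability that the
first `ℓ` coordinates of `x` are `σ` and the product of the corresponding marginals. -/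
def gap {n ℓ : ℕ} (h : ℓ ≤ n) (σ : Fin ℓ → ZMod 2) (A : Matrix (Fin n) (Fin n) (ZMod 2)) : ℝ :=
  |kerProb A (fun x => ∀ i : Fin ℓ, x (Fin.castLE h i) = σ i)
    - ∏ i : Fin ℓ, kerProb A (fun x => x (Fin.castLE h i) = σ i)|

end SparseParity

end

/-!
Call a coordinate frozen in a subspace if it vanishes identically there. Unless the `k`-th of the
first `ℓ` coordinates becomes frozen when the previous ones are pinned to zero, for some `k`, the
first `ℓ` coordinates of a uniformly random element of `ker 𝐀` are independent.

To bound the probability of that event, let operators act on functions of subspaces: `T` averages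
over imposing a random row of `𝐀`, and `U` over pinning a random coordinate to zero, so that
`𝔼 φ (ker 𝐀) = (Tⁿ φ) ⊤`. Averaged over the coordinates involved, the probability is the value at
`⊤` of `Tⁿ (1 - Uᵏ)` on the fraction of free coordinates, and permuting the columns of `𝐀` shows
that the first coordinates are no worse than `2 ^ (k + 1)` times the average.

A row is zero with probability bounded away from `0`, so `T = q • 1 + y` with `‖y‖ ≤ 1 - q`, and
expanding `Tⁿ` binomially bounds `‖Tⁿ (T - 1)‖` by the mean deviation of a binomial variable over
`n q`, of order `n ^ (-1 / 2)`. A row also has a single nonzero entry with probability bounded away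
from `0`, which yields the same bound for `‖Tⁿ (T - U)‖`. Hence `‖Tⁿ (1 - U)‖ = O(n ^ (-1 / 2))`.
-/

namespace SparseParity

open Asymptotics

section Binomial

theorem eval_bernsteinPolynomial (q : ℝ) (n k : ℕ) :
    (bernsteinPolynomial ℝ n k).eval q = n.choose k * q ^ k * (1 - q) ^ (n - k) := by
  simp [bernsteinPolynomial]

theorem sum_eval_bernsteinPolynomial_mul_abs_le (n : ℕ) {q : ℝ} (hq0 : 0 ≤ q) (hq1 : q ≤ 1) :
    ∑ k ∈ Finset.range (n + 1), (bernsteinPolynomial ℝ n k).eval q * |n * q - k|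
      ≤ √(n * q * (1 - q)) := by
  have hnonneg : ∀ k, 0 ≤ (bernsteinPolynomial ℝ n k).eval q := fun k => by
    have : 0 ≤ 1 - q := sub_nonneg.2 hq1
    rw [eval_bernsteinPolynomial]
    positivity
  have hsum : ∑ k ∈ Finset.range (n + 1), (bernsteinPolynomial ℝ n k).eval q = 1 := by
    simpa [Polynomial.eval_finsetSum] using
      congrArg (Polynomial.eval q) (bernsteinPolynomial.sum ℝ n)
  have hvar : ∑ k ∈ Finset.range (n + 1), (n * q - k) ^ 2 * (bernsteinPolynomial ℝ n k).eval q
      = n * q * (1 - q) := by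
    simpa [Polynomial.eval_finsetSum] using
      congrArg (Polynomial.eval q) (bernsteinPolynomial.variance ℝ n)
  refine Real.le_sqrt_of_sq_le ?_
  calc (∑ k ∈ Finset.range (n + 1), (bernsteinPolynomial ℝ n k).eval q * |n * q - k|) ^ 2
      ≤ (∑ k ∈ Finset.range (n + 1), (bernsteinPolynomial ℝ n k).eval q) *
          ∑ k ∈ Finset.range (n + 1), (n * q - k) ^ 2 * (bernsteinPolynomial ℝ n k).eval q :=
        Finset.sum_sq_le_sum_mul_sum_of_sq_le_mul _ (fun k _ => hnonneg k)
          (fun k _ => mul_nonneg (sq_nonneg _) (hnonneg k))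
          fun k _ => by rw [mul_pow, sq_abs]; exact le_of_eq (by ring)
    _ = n * q * (1 - q) := by rw [hsum, hvar, one_mul]

theorem succ_nsmul_add_pow_mul {R : Type*} [Semiring R] {x y : R} (hxy : Commute x y) (n : ℕ) :
    (n + 1) • ((x + y) ^ n * x) =
      ∑ k ∈ Finset.range (n + 2), (k * (n + 1).choose k) • (x ^ k * y ^ (n + 1 - k)) := by
  rw [Finset.sum_range_succ', hxy.add_pow, Finset.sum_mul, Finset.smul_sum]
  simp only [zero_mul, zero_smul, add_zero, Nat.add_sub_add_right]
  refine Finset.sum_congr rfl fun k _ => ?_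
  have hterm : x ^ k * y ^ (n - k) * (n.choose k : R) * x
      = n.choose k • (x ^ (k + 1) * y ^ (n - k)) := by
    rw [← (Nat.cast_commute _ _).eq, ← nsmul_eq_mul, smul_mul_assoc, mul_assoc,
      ← (hxy.pow_right _).eq, ← mul_assoc, ← pow_succ]
  rw [hterm, smul_smul, Nat.add_one_mul_choose_eq, mul_comm]

theorem succ_smul_add_pow_mul_smul_sub {𝔸 : Type*} [Ring 𝔸] [Algebra ℝ 𝔸] {x y : 𝔸}
    (hxy : Commute x y) (q : ℝ) (n : ℕ) :
    (n + 1 : ℝ) • ((x + y) ^ n * (q • (x + y) - x)) =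
      ∑ k ∈ Finset.range (n + 2),
        ((n + 1).choose k * ((n + 1 : ℕ) * q - k)) • (x ^ k * y ^ (n + 1 - k)) := by
  have hpow : (x + y) ^ (n + 1) =
      ∑ k ∈ Finset.range (n + 2), ((n + 1).choose k : ℝ) • (x ^ k * y ^ (n + 1 - k)) := by
    rw [hxy.add_pow]
    refine Finset.sum_congr rfl fun k _ => ?_
    rw [← (Nat.cast_commute _ _).eq, Nat.cast_smul_eq_nsmul, nsmul_eq_mul]
  have hmul : (n + 1 : ℝ) • ((x + y) ^ n * x) =
      ∑ k ∈ Finset.range (n + 2), (k * (n + 1).choose k : ℝ) • (x ^ k * y ^ (n + 1 - k)) := by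
    exact_mod_cast succ_nsmul_add_pow_mul hxy n
  rw [mul_sub, mul_smul_comm, ← pow_succ, smul_sub, hmul, hpow, smul_smul, Finset.smul_sum,
    ← Finset.sum_sub_distrib]
  refine Finset.sum_congr rfl fun k _ => ?_
  rw [smul_smul, ← sub_smul]
  congr 1
  push_cast
  ring

variable {𝔸 : Type*} [NormedRing 𝔸] [NormOneClass 𝔸]

theorem norm_pow_mul_pow_le {x y : 𝔸} {q r : ℝ} (hx : ‖x‖ ≤ q) (hy : ‖y‖ ≤ r) (k m : ℕ) :
    ‖x ^ k * y ^ m‖ ≤ q ^ k * r ^ m :=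
  calc ‖x ^ k * y ^ m‖ ≤ ‖x‖ ^ k * ‖y‖ ^ m :=
        norm_mul_le_of_le (norm_pow_le _ _) (norm_pow_le _ _)
    _ ≤ q ^ k * r ^ m := by
        have : 0 ≤ q := (norm_nonneg x).trans hx
        gcongr

theorem norm_add_pow_mul_smul_sub_le [NormedAlgebra ℝ 𝔸] {x y : 𝔸} (hxy : Commute x y) {q : ℝ}
    (hx : ‖x‖ ≤ q) (hy : ‖y‖ ≤ 1 - q) (n : ℕ) :
    ‖(x + y) ^ n * (q • (x + y) - x)‖ ≤ √(q * (1 - q) / (n + 1)) := by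
  have hq0 : 0 ≤ q := (norm_nonneg x).trans hx
  have hq1 : q ≤ 1 := sub_nonneg.1 ((norm_nonneg y).trans hy)
  have hn : (0 : ℝ) < n + 1 := by positivity
  have hscaled : (n + 1) * ‖(x + y) ^ n * (q • (x + y) - x)‖ ≤ √((n + 1 : ℕ) * q * (1 - q)) := by
    calc (n + 1) * ‖(x + y) ^ n * (q • (x + y) - x)‖
        = ‖(n + 1 : ℝ) • ((x + y) ^ n * (q • (x + y) - x))‖ := by
          rw [norm_smul, Real.norm_of_nonneg hn.le]
      _ ≤ ∑ k ∈ Finset.range (n + 2), ‖((n + 1).choose k * ((n + 1 : ℕ) * q - k)) •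
            (x ^ k * y ^ (n + 1 - k))‖ := by
          rw [succ_smul_add_pow_mul_smul_sub hxy]
          exact norm_sum_le _ _
      _ ≤ ∑ k ∈ Finset.range (n + 2),
            (bernsteinPolynomial ℝ (n + 1) k).eval q * |(n + 1 : ℕ) * q - k| := by
          refine Finset.sum_le_sum fun k _ => ?_
          rw [norm_smul, norm_mul, Real.norm_natCast, Real.norm_eq_abs, eval_bernsteinPolynomial,
            mul_assoc _ (q ^ k), mul_right_comm]
          gcongr
          exact norm_pow_mul_pow_le hx hy k _
      _ ≤ √((n + 1 : ℕ) * q * (1 - q)) := sum_eval_bernsteinPolynomial_mul_abs_le _ hq0 hq1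
  refine Real.le_sqrt_of_sq_le ?_
  rw [le_div_iff₀ hn]
  have := (Real.le_sqrt (by positivity) (by
    have := sub_nonneg.2 hq1; positivity)).1 hscaled
  push_cast at this
  refine le_of_mul_le_mul_left ?_ hn
  linarith

theorem norm_add_pow_mul_sub_le [NormedAlgebra ℝ 𝔸] {x y a : 𝔸} (hxy : Commute x y) {q : ℝ}
    (hq : 0 < q) (hxa : x = q • a) (hx : ‖x‖ ≤ q) (hy : ‖y‖ ≤ 1 - q) (n : ℕ) :
    ‖(x + y) ^ n * (x + y - a)‖ ≤ 1 / √((n + 1) * q) := by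
  have hfactor : (x + y) ^ n * (q • (x + y) - x) = q • ((x + y) ^ n * (x + y - a)) := by
    rw [← mul_smul_comm, smul_sub, ← hxa]
  have hvar : q * (1 - q) / (n + 1) ≤ q ^ 2 / ((n + 1) * q) := by
    rw [pow_two, mul_comm (n + 1 : ℝ), mul_div_mul_left _ _ hq.ne']
    gcongr
    exact mul_le_of_le_one_right hq.le (sub_le_self 1 hq.le)
  refine le_of_mul_le_mul_left ?_ hq
  calc q * ‖(x + y) ^ n * (x + y - a)‖ = ‖(x + y) ^ n * (q • (x + y) - x)‖ := by
        rw [hfactor, norm_smul, Real.norm_of_nonneg hq.le]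
    _ ≤ √(q * (1 - q) / (n + 1)) := norm_add_pow_mul_smul_sub_le hxy hx hy n
    _ ≤ √(q ^ 2 / ((n + 1) * q)) := Real.sqrt_le_sqrt hvar
    _ = q * (1 / √((n + 1) * q)) := by
        rw [Real.sqrt_div (sq_nonneg q), Real.sqrt_sq hq.le, mul_one_div]

theorem norm_mul_one_sub_pow_le {x a : 𝔸} (ha : ‖a‖ ≤ 1) (k : ℕ) :
    ‖x * (1 - a ^ k)‖ ≤ k * ‖x * (1 - a)‖ := by
  have hgeom : ‖∑ i ∈ Finset.range k, a ^ i‖ ≤ k := by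
    simpa using norm_sum_le_of_le (Finset.range k) fun i _ =>
      (norm_pow_le a i).trans (pow_le_one₀ (norm_nonneg a) ha)
  rw [← mul_neg_geom_sum, ← mul_assoc, mul_comm (k : ℝ)]
  exact norm_mul_le_of_le le_rfl hgeom

end Binomial

section MeetOperators

variable {L α : Type*}

/-- The operator `φ ↦ φ (· ⊓ h)` on real functions on a meet-semilattice. -/
noncomputable def meetOp [SemilatticeInf L] (h : L) : (L → ℝ) →L[ℝ] (L → ℝ) :=
  ContinuousLinearMap.pi fun K => ContinuousLinearMap.proj (K ⊓ h)

/-- The averaging operator of taking the meet with a random element: `h a` is drawn with weight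
`w a` among the `a ∈ s`. The total weight need not be one. -/
noncomputable def mixOp [SemilatticeInf L] (s : Finset α) (w : α → ℝ) (h : α → L) :
    (L → ℝ) →L[ℝ] (L → ℝ) :=
  ∑ a ∈ s, w a • meetOp (h a)

section Semilattice

variable [SemilatticeInf L]

theorem meetOp_apply (h : L) (φ : L → ℝ) (K : L) : meetOp h φ K = φ (K ⊓ h) := rfl

theorem meetOp_top [OrderTop L] : meetOp (⊤ : L) = 1 := by
  ext φ K
  simp [meetOp_apply]

theorem commute_meetOp (h h' : L) : Commute (meetOp h) (meetOp h') := by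
  ext φ K
  simp only [mul_apply_eq_comp, meetOp_apply, inf_right_comm K h h']

theorem norm_meetOp_le [Fintype L] (h : L) : ‖meetOp h‖ ≤ 1 :=
  ContinuousLinearMap.opNorm_le_bound _ zero_le_one fun φ => by
    rw [one_mul, pi_norm_le_iff_of_nonneg (norm_nonneg _)]
    exact fun K => norm_le_pi_norm φ (K ⊓ h)

theorem mixOp_apply (s : Finset α) (w : α → ℝ) (h : α → L) (φ : L → ℝ) (K : L) :
    mixOp s w h φ K = ∑ a ∈ s, w a * φ (K ⊓ h a) := by
  simp [mixOp, meetOp_apply]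

theorem commute_mixOp (s t : Finset α) (w : α → ℝ) (h : α → L) :
    Commute (mixOp s w h) (mixOp t w h) :=
  Commute.sum_left _ _ _ fun a _ => Commute.sum_right _ _ _ fun b _ =>
    ((commute_meetOp (h a) (h b)).smul_left _).smul_right _

theorem norm_mixOp_le [Fintype L] {s : Finset α} {w : α → ℝ} (hw : ∀ a ∈ s, 0 ≤ w a)
    (h : α → L) : ‖mixOp s w h‖ ≤ ∑ a ∈ s, w a :=
  norm_sum_le_of_le s fun a ha => by
    rw [norm_smul, Real.norm_of_nonneg (hw a ha)]
    exact mul_le_of_le_one_right (hw a ha) (norm_meetOp_le _)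

theorem norm_mixOp_pow_mul_sub_le [Fintype L] [Nonempty L] [Fintype α] {w : α → ℝ}
    (hw : ∀ a, 0 ≤ w a) (hw1 : ∑ a, w a = 1) (h : α → L) (s : Finset α)
    {U : (L → ℝ) →L[ℝ] (L → ℝ)} {q : ℝ} (hq : 0 < q) (hs : ∑ a ∈ s, w a = q)
    (hU : mixOp s w h = q • U) (n : ℕ) :
    ‖mixOp Finset.univ w h ^ n * (mixOp Finset.univ w h - U)‖ ≤ 1 / √((n + 1) * q) := by
  classical
  have hsplit : mixOp s w h + mixOp sᶜ w h = mixOp Finset.univ w h :=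
    Finset.sum_add_sum_compl s _
  have hcompl : ∑ a ∈ sᶜ, w a = 1 - q := by
    rw [← hw1, ← hs, ← Finset.sum_add_sum_compl s, add_sub_cancel_left]
  rw [← hsplit]
  exact norm_add_pow_mul_sub_le (commute_mixOp s sᶜ w h) hq hU
    (hs ▸ norm_mixOp_le (fun a _ => hw a) h) (hcompl ▸ norm_mixOp_le (fun a _ => hw a) h) n

end Semilattice

theorem mixOp_pow_apply [CompleteLattice L] [Fintype α] (w : α → ℝ) (h : α → L) (φ : L → ℝ)
    (m : ℕ) (K : L) :
    (mixOp Finset.univ w h ^ m) φ K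
      = ∑ Y : Fin m → α, (∏ i, w (Y i)) * φ (K ⊓ ⨅ i, h (Y i)) := by
  induction m generalizing K with
  | zero => simp
  | succ m ih =>
    rw [pow_succ', mul_apply_eq_comp, mixOp_apply,
      ← (Fin.consEquiv fun _ : Fin (m + 1) => α).sum_comp, Fintype.sum_prod_type]
    refine Finset.sum_congr rfl fun a _ => ?_
    rw [ih, Finset.mul_sum]
    refine Finset.sum_congr rfl fun Y _ => ?_
    have hinf : ⨅ i : Fin (m + 1), h (Fin.cons (α := fun _ => α) a Y i) = h a ⊓ ⨅ i, h (Y i) :=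
      eq_of_forall_le_iff fun c => by simp [Fin.forall_fin_succ]
    simp [Fin.prod_univ_succ, mul_assoc, inf_assoc, hinf]

end MeetOperators

section Freezing

variable {ι R : Type*} [Semiring R]

/-- The subspace of the vectors that vanish at the coordinate `j`. -/
def zeroAt (j : ι) : Submodule R (ι → R) := LinearMap.ker (LinearMap.proj j)

/-- The coordinate `j` is free in `K`, as opposed to frozen: it is not constantly zero on `K`. -/
def IsFree (K : Submodule R (ι → R)) (j : ι) : Prop := ∃ x ∈ K, x j ≠ 0

/-- The last coordinate listed by `I` is free in `K`, but is frozen once the preceding ones are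
pinned to zero. -/
def BecomesFrozen {k : ℕ} (K : Submodule R (ι → R)) (I : Fin (k + 1) → ι) : Prop :=
  IsFree K (I (Fin.last k)) ∧ ¬ IsFree (K ⊓ ⨅ i : Fin k, zeroAt (I i.castSucc)) (I (Fin.last k))

/-- The fraction of the coordinates that are free in `K`, or `0` if there are no coordinates. -/
noncomputable def freeFraction [Fintype ι] (K : Submodule R (ι → R)) : ℝ :=
  Nat.card {j // IsFree K j} / Fintype.card ι

theorem mem_zeroAt {j : ι} {x : ι → R} : x ∈ zeroAt j ↔ x j = 0 := Iff.rfl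

theorem IsFree.mono {K K' : Submodule R (ι → R)} (hK : K ≤ K') {j : ι} (hj : IsFree K j) :
    IsFree K' j :=
  hj.imp fun _ hx => ⟨hK hx.1, hx.2⟩

section FreeFraction

variable [Fintype ι]

theorem freeFraction_nonneg (K : Submodule R (ι → R)) : 0 ≤ freeFraction K := by
  unfold freeFraction
  positivity

theorem freeFraction_le_one (K : Submodule R (ι → R)) : freeFraction K ≤ 1 := by
  have hcard : Nat.card {j // IsFree K j} ≤ Fintype.card ι := by
    simpa using Nat.card_le_card_of_injective _ (Subtype.val_injective (p := IsFree K))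
  exact div_le_one_of_le₀ (by exact_mod_cast hcard) (by positivity)

theorem norm_freeFraction_le [Fintype (Submodule R (ι → R))] :
    ‖(freeFraction : Submodule R (ι → R) → ℝ)‖ ≤ 1 :=
  (pi_norm_le_iff_of_nonneg zero_le_one).2 fun K => by
    rw [Real.norm_of_nonneg (freeFraction_nonneg K)]
    exact freeFraction_le_one K

open Classical in
theorem card_mul_freeFraction (K : Submodule R (ι → R)) :
    Fintype.card ι * freeFraction K = ∑ j, if IsFree K j then 1 else 0 := by
  rw [Finset.sum_boole, ← Fintype.card_subtype, freeFraction, Nat.card_eq_fintype_card,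
    mul_div_cancel_of_imp']
  intro h
  have : IsEmpty ι := Fintype.card_eq_zero_iff.1 (by exact_mod_cast h)
  simp

open Classical in
theorem sum_becomesFrozen_snoc {k : ℕ} (K : Submodule R (ι → R)) (J : Fin k → ι) :
    ∑ j, (if BecomesFrozen K (Fin.snoc (α := fun _ => ι) J j) then (1 : ℝ) else 0)
      = Fintype.card ι * (freeFraction K - freeFraction (K ⊓ ⨅ i, zeroAt (J i))) := by
  rw [mul_sub, card_mul_freeFraction, card_mul_freeFraction, ← Finset.sum_sub_distrib]
  refine Finset.sum_congr rfl fun j _ => ?_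
  have hmono : IsFree (K ⊓ ⨅ i, zeroAt (J i)) j → IsFree K j := IsFree.mono inf_le_left
  simp only [BecomesFrozen, Fin.snoc_last, Fin.snoc_castSucc]
  by_cases hfree : IsFree K j <;> by_cases hpinned : IsFree (K ⊓ ⨅ i, zeroAt (J i)) j <;>
    simp_all

variable (R ι) in
/-- The averaging operator of pinning a uniformly random coordinate to zero. -/
noncomputable def pinOp : (Submodule R (ι → R) → ℝ) →L[ℝ] (Submodule R (ι → R) → ℝ) :=
  mixOp Finset.univ (fun _ => (Fintype.card ι : ℝ)⁻¹) zeroAt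

theorem norm_pinOp_le [Fintype (Submodule R (ι → R))] : ‖pinOp ι R‖ ≤ 1 := by
  refine (norm_mixOp_le (fun _ _ => by positivity) _).trans ?_
  rw [Finset.sum_const, Finset.card_univ, nsmul_eq_mul]
  exact mul_inv_le_one

theorem card_pow_mul_pinOp_pow_apply [Nonempty ι] (φ : Submodule R (ι → R) → ℝ) (k : ℕ)
    (K : Submodule R (ι → R)) :
    (Fintype.card ι : ℝ) ^ k * (pinOp ι R ^ k) φ K
      = ∑ J : Fin k → ι, φ (K ⊓ ⨅ i, zeroAt (J i)) := by
  rw [pinOp, mixOp_pow_apply, Finset.mul_sum]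
  simp

open Classical in
theorem sum_becomesFrozen (k : ℕ) (K : Submodule R (ι → R)) :
    ∑ I : Fin (k + 1) → ι, (if BecomesFrozen K I then (1 : ℝ) else 0)
      = Fintype.card ι ^ (k + 1) * ((1 - pinOp ι R ^ k) freeFraction K) := by
  cases isEmpty_or_nonempty ι
  · simp
  calc ∑ I : Fin (k + 1) → ι, (if BecomesFrozen K I then (1 : ℝ) else 0)
      = ∑ J : Fin k → ι, ∑ j,
          if BecomesFrozen K (Fin.snoc (α := fun _ => ι) J j) then (1 : ℝ) else 0 := by
        rw [← (Fin.snocEquiv fun _ : Fin (k + 1) => ι).sum_comp, Fintype.sum_prod_type,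
          Finset.sum_comm]
        rfl
    _ = Fintype.card ι * (Fintype.card ι ^ k * freeFraction K
          - ∑ J : Fin k → ι, freeFraction (K ⊓ ⨅ i, zeroAt (J i))) := by
        simp only [sum_becomesFrozen_snoc]
        rw [← Finset.mul_sum, Finset.sum_sub_distrib]
        simp
    _ = Fintype.card ι ^ (k + 1) * ((1 - pinOp ι R ^ k) freeFraction K) := by
        rw [← card_pow_mul_pinOp_pow_apply, ← mul_sub, ← mul_assoc, ← pow_succ']
        rfl

end FreeFraction

end Freezing

theorem becomesFrozen_submatrix {ι m R : Type*} [Fintype ι] [CommSemiring R] {k : ℕ}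
    (A : Matrix m ι R) (π : Equiv.Perm ι) (I : Fin (k + 1) → ι) :
    BecomesFrozen (LinearMap.ker (A.submatrix id π).mulVecLin) I
      ↔ BecomesFrozen (LinearMap.ker A.mulVecLin) (π ∘ I) := by
  have hker (x : ι → R) : x ∘ π ∈ LinearMap.ker (A.submatrix id π).mulVecLin
      ↔ x ∈ LinearMap.ker A.mulVecLin := by
    have : (A.submatrix id π).mulVec (x ∘ π) = A.mulVec x := by
      simp [Matrix.submatrix_mulVec_equiv, Function.comp_assoc]
    simp only [LinearMap.mem_ker, Matrix.mulVecLin_apply, this]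
  have hsubst {P : (ι → R) → Prop} : (∃ x, P x) ↔ ∃ x, P (x ∘ π) :=
    (π.arrowCongr (Equiv.refl R)).symm.surjective.exists
  simp only [BecomesFrozen, IsFree, Submodule.mem_inf, Submodule.mem_iInf, mem_zeroAt]
  refine and_congr (hsubst.trans ?_) (not_congr (hsubst.trans ?_)) <;>
    simp only [hker, Function.comp_apply]

section KernelProbability

variable {n : ℕ} {A : Matrix (Fin n) (Fin n) (ZMod 2)} {P Q : (Fin n → ZMod 2) → Prop}

theorem kerProb_nonneg : 0 ≤ kerProb A P := by
  unfold kerProb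
  positivity

theorem kerProb_le_one : kerProb A P ≤ 1 :=
  div_le_one_of_le₀ (by exact_mod_cast Nat.card_le_card_of_injective _ Subtype.val_injective)
    (by positivity)

theorem kerProb_congr (h : ∀ x ∈ LinearMap.ker A.mulVecLin, (P x ↔ Q x)) :
    kerProb A P = kerProb A Q := by
  unfold kerProb
  rw [Nat.card_congr (Equiv.subtypeEquivRight fun x : LinearMap.ker A.mulVecLin => h x x.2)]

theorem kerProb_false : kerProb A (fun _ => False) = 0 := by
  simp [kerProb]

theorem kerProb_true : kerProb A (fun _ => True) = 1 := by
  unfold kerProb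
  rw [Nat.card_congr (Equiv.subtypeUnivEquiv fun _ => trivial)]
  exact div_self (by exact_mod_cast Nat.card_pos.ne')

theorem kerProb_and_const (p : Prop) :
    kerProb A (fun x => P x ∧ p) = kerProb A P * kerProb A (fun _ => p) := by
  by_cases hp : p <;> simp [hp, kerProb_true, kerProb_false]

theorem kerProb_and_add_kerProb_and_not (A : Matrix (Fin n) (Fin n) (ZMod 2))
    (P Q : (Fin n → ZMod 2) → Prop) :
    kerProb A (fun x => P x ∧ Q x) + kerProb A (fun x => P x ∧ ¬ Q x) = kerProb A P := by
  classical
  unfold kerProb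
  rw [← add_div, ← Nat.cast_add]
  simp only [Nat.card_eq_fintype_card, Fintype.card_subtype]
  rw [← Finset.filter_filter, ← Finset.filter_filter, Finset.card_filter_add_card_filter_not]

theorem kerProb_translate {v : Fin n → ZMod 2} (hv : v ∈ LinearMap.ker A.mulVecLin)
    (P : (Fin n → ZMod 2) → Prop) : kerProb A (fun x => P (x + v)) = kerProb A P := by
  unfold kerProb
  congr 2
  exact Nat.card_congr ((Equiv.addRight (⟨v, hv⟩ : LinearMap.ker A.mulVecLin)).subtypeEquiv
    fun _ => Iff.rfl)

theorem kerProb_and_coord_eq_half {v : Fin n → ZMod 2} (hv : v ∈ LinearMap.ker A.mulVecLin)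
    {j : Fin n} (hj : v j ≠ 0) (hP : ∀ x, P (x + v) ↔ P x) (s : ZMod 2) :
    kerProb A (fun x => P x ∧ x j = s) = kerProb A P / 2 := by
  have hflip : ∀ a b c : ZMod 2, b ≠ 0 → (¬ a + b = c ↔ a = c) := by decide
  have hsymm : kerProb A (fun x => P x ∧ x j = s) = kerProb A (fun x => P x ∧ ¬ x j = s) := by
    rw [← kerProb_translate hv fun x => P x ∧ ¬ x j = s]
    exact kerProb_congr fun x _ => by rw [hP, Pi.add_apply, hflip _ _ _ hj]
  linarith [kerProb_and_add_kerProb_and_not A P fun x => x j = s]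

theorem kerProb_and_coord_of_not_isFree {j : Fin n}
    (hj : ¬ IsFree (LinearMap.ker A.mulVecLin) j) (P : (Fin n → ZMod 2) → Prop) (s : ZMod 2) :
    kerProb A (fun x => P x ∧ x j = s) = kerProb A P * kerProb A (fun x => x j = s) := by
  have hzero : ∀ x ∈ LinearMap.ker A.mulVecLin, x j = 0 := by simpa [IsFree] using hj
  rw [kerProb_congr fun x hx => by rw [hzero x hx], kerProb_and_const,
    kerProb_congr (P := fun x => x j = s) fun x hx => by rw [hzero x hx]]

theorem kerProb_and_coord_of_invariant {v : Fin n → ZMod 2}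
    (hv : v ∈ LinearMap.ker A.mulVecLin) {j : Fin n} (hj : v j ≠ 0)
    (hP : ∀ x, P (x + v) ↔ P x) (s : ZMod 2) :
    kerProb A (fun x => P x ∧ x j = s) = kerProb A P * kerProb A (fun x => x j = s) := by
  have huniform := kerProb_and_coord_eq_half hv hj (P := fun _ => True) (fun _ => Iff.rfl) s
  simp only [true_and, kerProb_true] at huniform
  rw [kerProb_and_coord_eq_half hv hj hP, huniform, mul_one_div]

theorem kerProb_forall_succ_of_not_becomesFrozen {k : ℕ} {I : Fin (k + 1) → Fin n}
    (hI : ¬ BecomesFrozen (LinearMap.ker A.mulVecLin) I) (σ : Fin (k + 1) → ZMod 2) :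
    kerProb A (fun x => ∀ i, x (I i) = σ i)
      = kerProb A (fun x => ∀ i : Fin k, x (I i.castSucc) = σ i.castSucc)
        * kerProb A (fun x => x (I (Fin.last k)) = σ (Fin.last k)) := by
  simp only [Fin.forall_fin_succ']
  by_cases hfree : IsFree (LinearMap.ker A.mulVecLin) (I (Fin.last k))
  · obtain ⟨v, ⟨hvA, hv0⟩, hvj⟩ := not_and_not_right.1 hI hfree
    have hv0 (i : Fin k) : v (I i.castSucc) = 0 := Submodule.mem_iInf _ |>.1 hv0 i
    exact kerProb_and_coord_of_invariant hvA hvj (fun x => by simp [hv0]) _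
  · exact kerProb_and_coord_of_not_isFree hfree _ _

theorem kerProb_forall_eq_prod {m : ℕ} {I : Fin m → Fin n} (σ : Fin m → ZMod 2)
    (hI : ∀ k : Fin m, ¬ BecomesFrozen (LinearMap.ker A.mulVecLin)
      fun i : Fin (k + 1) => I (Fin.castLE k.2 i)) :
    kerProb A (fun x => ∀ i, x (I i) = σ i) = ∏ i, kerProb A (fun x => x (I i) = σ i) := by
  induction m with
  | zero => simp [kerProb_true]
  | succ m ih =>
    rw [Fin.prod_univ_castSucc,
      kerProb_forall_succ_of_not_becomesFrozen (I := I) (hI (Fin.last m)),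
      ih (I := fun i => I i.castSucc) (fun i => σ i.castSucc) fun k => hI k.castSucc]

theorem gap_nonneg {ℓ : ℕ} (h : ℓ ≤ n) (σ : Fin ℓ → ZMod 2) : 0 ≤ gap h σ A := abs_nonneg _

theorem gap_le_one {ℓ : ℕ} (h : ℓ ≤ n) (σ : Fin ℓ → ZMod 2) : gap h σ A ≤ 1 :=
  abs_sub_le_of_nonneg_of_le kerProb_nonneg kerProb_le_one
    (Finset.prod_nonneg fun _ _ => kerProb_nonneg)
    (Finset.prod_le_one (fun _ _ => kerProb_nonneg) fun _ _ => kerProb_le_one)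

open Classical in
theorem gap_le_sum_becomesFrozen {ℓ : ℕ} (h : ℓ ≤ n) (σ : Fin ℓ → ZMod 2)
    (A : Matrix (Fin n) (Fin n) (ZMod 2)) :
    gap h σ A ≤ ∑ k : Fin ℓ, if BecomesFrozen (LinearMap.ker A.mulVecLin)
      (fun i : Fin (k + 1) => Fin.castLE h (Fin.castLE k.2 i)) then 1 else 0 := by
  set frozenAt : Fin ℓ → Prop := fun k => BecomesFrozen (LinearMap.ker A.mulVecLin)
    fun i : Fin (k + 1) => Fin.castLE h (Fin.castLE k.2 i)
  have hterm (k : Fin ℓ) : (0 : ℝ) ≤ if frozenAt k then 1 else 0 := by positivity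
  by_cases hA : ∃ k, frozenAt k
  · obtain ⟨k, hk⟩ := hA
    calc gap h σ A ≤ 1 := gap_le_one h σ
      _ = if frozenAt k then 1 else 0 := (if_pos hk).symm
      _ ≤ ∑ k, if frozenAt k then 1 else 0 :=
        Finset.single_le_sum (fun k _ => hterm k) (Finset.mem_univ k)
  · rw [gap, kerProb_forall_eq_prod σ (not_exists.1 hA), sub_self, abs_zero]
    exact Finset.sum_nonneg fun k _ => hterm k

end KernelProbability

section RandomRows

variable {ι : Type*} [Fintype ι] {p : ℝ}

/-- The probability that a vector over `𝔽₂` with independent entries, equal to `1` with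
probability `p` and to `0` otherwise, takes the value `r`. -/
noncomputable def rowProb (p : ℝ) (r : ι → ZMod 2) : ℝ := ∏ j, if r j = 1 then p else 1 - p

/-- The subspace of the vectors orthogonal to `r` under the dot product. -/
def orth {R : Type*} [CommSemiring R] (r : ι → R) : Submodule R (ι → R) :=
  LinearMap.ker (dotProductBilin R R r)

theorem rowProb_nonneg (hp0 : 0 ≤ p) (hp1 : p ≤ 1) (r : ι → ZMod 2) : 0 ≤ rowProb p r :=
  Finset.prod_nonneg fun j _ => by
    have : 0 ≤ 1 - p := sub_nonneg.2 hp1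
    positivity

theorem rowProb_zero : rowProb p (0 : ι → ZMod 2) = (1 - p) ^ Fintype.card ι := by
  simp [rowProb]

theorem mem_orth {R : Type*} [CommSemiring R] {r x : ι → R} : x ∈ orth r ↔ r ⬝ᵥ x = 0 := Iff.rfl

theorem orth_zero {R : Type*} [CommSemiring R] : orth (0 : ι → R) = ⊤ := by
  ext x
  simp [mem_orth]

theorem ker_mulVecLin_eq_iInf_orth {m R : Type*} [CommSemiring R] (A : Matrix m ι R) :
    LinearMap.ker A.mulVecLin = ⨅ i, orth (A i) := by
  ext x
  simp [mem_orth, funext_iff, Matrix.mulVec, Submodule.mem_iInf]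

variable [DecidableEq ι]

theorem sum_rowProb (p : ℝ) : ∑ r : ι → ZMod 2, rowProb p r = 1 := by
  have hbit : ∑ a : ZMod 2, (if a = 1 then p else 1 - p) = 1 := by
    rw [show (Finset.univ : Finset (ZMod 2)) = {0, 1} from rfl, Finset.sum_pair zero_ne_one]
    simp
  simp only [rowProb, ← Fintype.prod_sum fun (_ : ι) (a : ZMod 2) => if a = 1 then p else 1 - p,
    hbit, Finset.prod_const_one]

theorem rowProb_single (j : ι) :
    rowProb p (Pi.single j 1) = p * (1 - p) ^ (Fintype.card ι - 1) := by
  rw [rowProb, Fintype.prod_eq_mul_prod_compl j, Pi.single_eq_same, if_pos rfl,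
    Finset.prod_eq_pow_card (b := 1 - p), Finset.card_compl, Finset.card_singleton]
  intro i hi
  have hij : i ≠ j := by simpa using hi
  rw [Pi.single_eq_of_ne hij, if_neg zero_ne_one]

theorem orth_single {R : Type*} [CommSemiring R] (j : ι) :
    orth (Pi.single j 1 : ι → R) = zeroAt j := by
  ext x
  simp [mem_orth, mem_zeroAt]

variable (ι) in
/-- The averaging operator of imposing orthogonality to a random row with density `p`. -/
noncomputable def rowOp (p : ℝ) :
    (Submodule (ZMod 2) (ι → ZMod 2) → ℝ) →L[ℝ] (Submodule (ZMod 2) (ι → ZMod 2) → ℝ) :=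
  mixOp Finset.univ (rowProb p) orth

/-- A row is zero with probability `(1 - p) ^ |ι|`, and then imposes nothing. -/
theorem norm_rowOp_pow_mul_sub_one_le (hp0 : 0 ≤ p) (hp1 : p < 1) (m : ℕ) :
    ‖rowOp ι p ^ m * (rowOp ι p - 1)‖ ≤ 1 / √((m + 1) * (1 - p) ^ Fintype.card ι) := by
  refine norm_mixOp_pow_mul_sub_le (rowProb_nonneg hp0 hp1.le) (sum_rowProb p) orth {0}
    (pow_pos (sub_pos.2 hp1) _) ?_ ?_ m
  · rw [Finset.sum_singleton, rowProb_zero]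
  · rw [mixOp, Finset.sum_singleton, rowProb_zero, orth_zero, meetOp_top]

/-- A row has a single nonzero entry with probability `|ι| * (p * (1 - p) ^ (|ι| - 1))`, and then
pins a uniformly random coordinate to zero. -/
theorem norm_rowOp_pow_mul_sub_pinOp_le [Nonempty ι] (hp0 : 0 < p) (hp1 : p < 1) (m : ℕ) :
    ‖rowOp ι p ^ m * (rowOp ι p - pinOp ι (ZMod 2))‖
      ≤ 1 / √((m + 1) * (Fintype.card ι * (p * (1 - p) ^ (Fintype.card ι - 1)))) := by
  have hpow : 0 < (1 - p) ^ (Fintype.card ι - 1) := pow_pos (sub_pos.2 hp1) _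
  have hinj : Function.Injective fun j : ι => (Pi.single j 1 : ι → ZMod 2) := fun i j hij => by
    simpa [Pi.single_apply] using congrFun hij i
  refine norm_mixOp_pow_mul_sub_le (rowProb_nonneg hp0.le hp1.le) (sum_rowProb p) orth
    (Finset.univ.map ⟨_, hinj⟩) (by positivity) ?_ ?_ m
  · simp [rowProb_single]
  · ext φ K
    simp only [mixOp_apply, pinOp, Finset.sum_map, Function.Embedding.coeFn_mk, rowProb_single,
      orth_single, FunLike.coe_smul, Pi.smul_apply, smul_eq_mul, Finset.mul_sum]
    refine Finset.sum_congr rfl fun j _ => ?_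
    field_simp

end RandomRows

section Symmetrization

theorem pow_le_two_pow_mul_descFactorial {n m : ℕ} (h : 2 * m ≤ n) :
    n ^ m ≤ 2 ^ m * n.descFactorial m :=
  calc n ^ m ≤ (2 * (n + 1 - m)) ^ m := Nat.pow_le_pow_left (by omega) m
    _ = 2 ^ m * (n + 1 - m) ^ m := mul_pow _ _ _
    _ ≤ 2 ^ m * n.descFactorial m := Nat.mul_le_mul_left _ (Nat.pow_sub_le_descFactorial n m)

variable {α : Type*} [Fintype α] {m : ℕ} {F : (Fin m → α) → ℝ}

theorem descFactorial_card_mul_le_sum (hF0 : ∀ J, 0 ≤ F J)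
    (hF : ∀ (π : Equiv.Perm α) (J : Fin m → α), F (π ∘ J) = F J) (I : Fin m ↪ α) :
    (Fintype.card α).descFactorial m * F I ≤ ∑ J, F J := by
  classical
  have hconst (J : Fin m ↪ α) : F J = F I := by
    obtain ⟨π, rfl⟩ := (Equiv.Perm.isMultiplyPretransitive α m).exists_smul_eq I J
    exact hF π I
  have hcard : Fintype.card (Fin m ↪ α) = (Fintype.card α).descFactorial m := by
    rw [Fintype.card_embedding_eq, Fintype.card_fin]
  calc (Fintype.card α).descFactorial m * F I = ∑ J : Fin m ↪ α, F J := by simp [hconst, hcard]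
    _ = ∑ J ∈ Finset.univ.map ⟨fun J : Fin m ↪ α => ⇑J, DFunLike.coe_injective⟩, F J := by
      rw [Finset.sum_map, Function.Embedding.coeFn_mk]
    _ ≤ ∑ J, F J := Finset.sum_le_univ_sum_of_nonneg hF0

theorem card_pow_mul_le_sum (hm : 2 * m ≤ Fintype.card α) (hF0 : ∀ J, 0 ≤ F J)
    (hF : ∀ (π : Equiv.Perm α) (J : Fin m → α), F (π ∘ J) = F J) (I : Fin m ↪ α) :
    Fintype.card α ^ m * F I ≤ 2 ^ m * ∑ J, F J := by
  have hdesc : (Fintype.card α : ℝ) ^ m ≤ 2 ^ m * (Fintype.card α).descFactorial m := by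
    exact_mod_cast pow_le_two_pow_mul_descFactorial hm
  calc Fintype.card α ^ m * F I ≤ 2 ^ m * (Fintype.card α).descFactorial m * F I :=
        mul_le_mul_of_nonneg_right hdesc (hF0 I)
    _ = 2 ^ m * ((Fintype.card α).descFactorial m * F I) := mul_assoc _ _ _
    _ ≤ 2 ^ m * ∑ J, F J := by gcongr; exact descFactorial_card_mul_le_sum hF0 hF I

end Symmetrization

section Expectation

variable {d : ℝ} {n : ℕ}

theorem entryProb_nonneg (hd : 0 ≤ d) : 0 ≤ entryProb d n := le_min (by positivity) zero_le_one

theorem matrixProb_nonneg (hd : 0 ≤ d) (A : Matrix (Fin n) (Fin n) (ZMod 2)) :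
    0 ≤ matrixProb d n A :=
  Finset.prod_nonneg fun i _ => rowProb_nonneg (entryProb_nonneg hd) (min_le_right _ _) (A i)

theorem matrixProb_submatrix (A : Matrix (Fin n) (Fin n) (ZMod 2)) (π : Equiv.Perm (Fin n)) :
    matrixProb d n (A.submatrix id π) = matrixProb d n A :=
  Finset.prod_congr rfl fun i _ =>
    Equiv.prod_comp π fun j => if A i j = 1 then entryProb d n else 1 - entryProb d n

theorem expect_sum {ι : Type*} (s : Finset ι) (F : ι → Matrix (Fin n) (Fin n) (ZMod 2) → ℝ) :
    expect d n (fun A => ∑ i ∈ s, F i A) = ∑ i ∈ s, expect d n (F i) := by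
  simp only [expect, Finset.mul_sum]
  exact Finset.sum_comm

theorem expect_const_mul (c : ℝ) (F : Matrix (Fin n) (Fin n) (ZMod 2) → ℝ) :
    expect d n (fun A => c * F A) = c * expect d n F := by
  simp only [expect, Finset.mul_sum, mul_left_comm]

theorem expect_mono (hd : 0 ≤ d) {F G : Matrix (Fin n) (Fin n) (ZMod 2) → ℝ}
    (h : ∀ A, F A ≤ G A) : expect d n F ≤ expect d n G :=
  Finset.sum_le_sum fun A _ => mul_le_mul_of_nonneg_left (h A) (matrixProb_nonneg hd A)

theorem expect_nonneg (hd : 0 ≤ d) {F : Matrix (Fin n) (Fin n) (ZMod 2) → ℝ}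
    (h : ∀ A, 0 ≤ F A) : 0 ≤ expect d n F :=
  Finset.sum_nonneg fun A _ => mul_nonneg (matrixProb_nonneg hd A) (h A)

theorem expect_ker (φ : Submodule (ZMod 2) (Fin n → ZMod 2) → ℝ) :
    expect d n (fun A => φ (LinearMap.ker A.mulVecLin))
      = (rowOp (Fin n) (entryProb d n) ^ n) φ ⊤ := by
  rw [rowOp, mixOp_pow_apply]
  refine Finset.sum_congr rfl fun A _ => ?_
  rw [top_inf_eq, ← ker_mulVecLin_eq_iInf_orth]
  rfl

end Expectation

section FreezeProbability

variable {d : ℝ} {n k : ℕ}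

open Classical in
/-- The probability that, in the kernel of the random matrix, the last coordinate listed by `I` is
free but becomes frozen once the preceding ones are pinned to zero. -/
noncomputable def freezeProb (d : ℝ) {n k : ℕ} (I : Fin (k + 1) → Fin n) : ℝ :=
  expect d n fun A => if BecomesFrozen (LinearMap.ker A.mulVecLin) I then 1 else 0

theorem freezeProb_nonneg (hd : 0 ≤ d) (I : Fin (k + 1) → Fin n) : 0 ≤ freezeProb d I :=
  expect_nonneg hd fun A => by positivity

theorem freezeProb_perm_comp (π : Equiv.Perm (Fin n)) (I : Fin (k + 1) → Fin n) :
    freezeProb d (π ∘ I) = freezeProb d I := by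
  classical
  refine Fintype.sum_equiv (Matrix.reindex (Equiv.refl (Fin n)) π.symm) _ _ fun A => ?_
  exact congrArg₂ (· * ·) (matrixProb_submatrix A π).symm
    (if_congr (becomesFrozen_submatrix A π I).symm rfl rfl)

theorem sum_freezeProb (d : ℝ) (n k : ℕ) :
    ∑ I : Fin (k + 1) → Fin n, freezeProb d I = n ^ (k + 1) *
      (rowOp (Fin n) (entryProb d n) ^ n * (1 - pinOp (Fin n) (ZMod 2) ^ k)) freeFraction ⊤ := by
  simp only [freezeProb]
  rw [← expect_sum]
  simp only [sum_becomesFrozen]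
  rw [expect_const_mul, expect_ker, Fintype.card_fin]
  rfl

theorem sum_freezeProb_le (d : ℝ) (n k : ℕ) :
    ∑ I : Fin (k + 1) → Fin n, freezeProb d I ≤ n ^ (k + 1) *
      ‖rowOp (Fin n) (entryProb d n) ^ n * (1 - pinOp (Fin n) (ZMod 2) ^ k)‖ := by
  rw [sum_freezeProb]
  gcongr
  set D := rowOp (Fin n) (entryProb d n) ^ n * (1 - pinOp (Fin n) (ZMod 2) ^ k)
  calc D freeFraction ⊤ ≤ ‖D freeFraction ⊤‖ := Real.le_norm_self _
    _ ≤ ‖D freeFraction‖ := norm_le_pi_norm _ _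
    _ ≤ ‖D‖ := D.unit_le_opNorm _ norm_freeFraction_le

theorem freezeProb_le (hd : 0 ≤ d) (hk : 2 * (k + 1) ≤ n) (I : Fin (k + 1) ↪ Fin n) :
    freezeProb d I ≤
      2 ^ (k + 1) * ‖rowOp (Fin n) (entryProb d n) ^ n * (1 - pinOp (Fin n) (ZMod 2) ^ k)‖ := by
  have hn : (0 : ℝ) < n ^ (k + 1) := by
    have : 0 < n := by omega
    positivity
  refine le_of_mul_le_mul_left ?_ hn
  calc n ^ (k + 1) * freezeProb d I
      ≤ 2 ^ (k + 1) * ∑ J : Fin (k + 1) → Fin n, freezeProb d J := by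
        simpa using card_pow_mul_le_sum (by simpa using hk) (freezeProb_nonneg hd)
          freezeProb_perm_comp I
    _ ≤ 2 ^ (k + 1) * (n ^ (k + 1) *
          ‖rowOp (Fin n) (entryProb d n) ^ n * (1 - pinOp (Fin n) (ZMod 2) ^ k)‖) := by
        gcongr
        exact sum_freezeProb_le d n k
    _ = _ := mul_left_comm _ _ _

theorem expect_gap_le (hd : 0 ≤ d) {ℓ : ℕ} (h : ℓ ≤ n) (hℓ : 2 * ℓ ≤ n) (σ : Fin ℓ → ZMod 2) :
    expect d n (gap h σ) ≤ 2 ^ ℓ * ℓ ^ 2 *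
      ‖rowOp (Fin n) (entryProb d n) ^ n * (1 - pinOp (Fin n) (ZMod 2))‖ := by
  set T := rowOp (Fin n) (entryProb d n)
  set U := pinOp (Fin n) (ZMod 2)
  have hfreeze (k : Fin ℓ) : freezeProb d (fun i : Fin (k + 1) => Fin.castLE h (Fin.castLE k.2 i))
      ≤ 2 ^ ℓ * (ℓ * ‖T ^ n * (1 - U)‖) :=
    calc freezeProb d (fun i : Fin (k + 1) => Fin.castLE h (Fin.castLE k.2 i))
        ≤ 2 ^ ((k : ℕ) + 1) * ‖T ^ n * (1 - U ^ (k : ℕ))‖ :=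
          freezeProb_le hd (by omega) ((Fin.castLEEmb k.2).trans (Fin.castLEEmb h))
      _ ≤ 2 ^ ((k : ℕ) + 1) * ((k : ℕ) * ‖T ^ n * (1 - U)‖) := by
          gcongr
          exact norm_mul_one_sub_pow_le norm_pinOp_le k
      _ ≤ 2 ^ ℓ * (ℓ * ‖T ^ n * (1 - U)‖) := by
          gcongr
          · exact one_le_two
          · exact k.2
          · exact k.2.le
  classical
  calc expect d n (gap h σ)
      ≤ ∑ k : Fin ℓ, freezeProb d (fun i : Fin (k + 1) => Fin.castLE h (Fin.castLE k.2 i)) := by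
        simp only [freezeProb]
        rw [← expect_sum]
        exact expect_mono hd (gap_le_sum_becomesFrozen h σ)
    _ ≤ ∑ _k : Fin ℓ, 2 ^ ℓ * (ℓ * ‖T ^ n * (1 - U)‖) := Finset.sum_le_sum fun k _ => hfreeze k
    _ = 2 ^ ℓ * ℓ ^ 2 * ‖T ^ n * (1 - U)‖ := by
        rw [Finset.sum_const, Finset.card_univ, Fintype.card_fin, nsmul_eq_mul]
        ring

end FreezeProbability

section Limits

variable {d : ℝ}

theorem eventually_entryProb_eq (d : ℝ) : ∀ᶠ n : ℕ in atTop, entryProb d n = d / n := by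
  filter_upwards [eventually_ge_atTop ⌈d⌉₊] with n hn
  exact min_eq_left (div_le_one_of_le₀ (Nat.ceil_le.1 hn) n.cast_nonneg)

theorem eventually_entryProb_lt_one (d : ℝ) : ∀ᶠ n : ℕ in atTop, entryProb d n < 1 := by
  filter_upwards [eventually_entryProb_eq d, eventually_gt_atTop ⌈d⌉₊] with n hp hn
  have hdn : d < n := Nat.lt_of_ceil_lt hn
  rw [hp, div_lt_one₀ (by exact_mod_cast (Nat.zero_le _).trans_lt hn)]
  exact hdn

theorem tendsto_entryProb (d : ℝ) : Tendsto (entryProb d) atTop (𝓝 0) :=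
  (tendsto_const_div_atTop_nhds_zero_nat d).congr'
    ((eventually_entryProb_eq d).mono fun _ h => h.symm)

theorem tendsto_natCast_mul_entryProb (d : ℝ) :
    Tendsto (fun n : ℕ => n * entryProb d n) atTop (𝓝 d) := by
  refine tendsto_const_nhds.congr' ?_
  filter_upwards [eventually_entryProb_eq d, eventually_ne_atTop 0] with n hp hn
  rw [hp, mul_div_cancel₀ _ (by exact_mod_cast hn)]

theorem tendsto_one_sub_entryProb_pow (d : ℝ) :
    Tendsto (fun n : ℕ => (1 - entryProb d n) ^ n) atTop (𝓝 (Real.exp (-d))) := by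
  refine (Real.tendsto_one_add_div_pow_exp (-d)).congr' ?_
  filter_upwards [eventually_entryProb_eq d] with n hp
  rw [hp, neg_div, sub_eq_add_neg]

theorem tendsto_one_sub_entryProb_pow_pred (d : ℝ) :
    Tendsto (fun n : ℕ => (1 - entryProb d n) ^ (n - 1)) atTop (𝓝 (Real.exp (-d))) := by
  have hlim := (tendsto_one_sub_entryProb_pow d).div ((tendsto_entryProb d).const_sub 1)
    (by norm_num)
  rw [sub_zero, div_one] at hlim
  refine hlim.congr' ?_
  filter_upwards [eventually_entryProb_lt_one d, eventually_ne_atTop 0] with n hp hn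
  rw [Pi.div_apply, div_eq_iff (sub_pos.2 hp).ne', pow_sub_one_mul hn]

theorem isBigO_one_div_sqrt_mul {u : ℕ → ℝ} {a : ℝ} (ha : 0 < a) (hu : Tendsto u atTop (𝓝 a)) :
    (fun n : ℕ => 1 / √((n + 1) * u n)) =O[atTop] fun n : ℕ => (n : ℝ) ^ (-(1 / 2) : ℝ) := by
  refine IsBigO.of_bound (1 / √(a / 2)) ?_
  filter_upwards [hu.eventually_const_le (half_lt_self ha), eventually_gt_atTop 0] with n hun hn
  have hn : (0 : ℝ) < n := by exact_mod_cast hn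
  rw [Real.norm_of_nonneg (by positivity), Real.norm_of_nonneg (by positivity),
    Real.rpow_neg hn.le, ← Real.sqrt_eq_rpow, ← one_div, one_div_mul_one_div,
    ← Real.sqrt_mul (by positivity), mul_comm (a / 2)]
  gcongr
  exact le_add_of_nonneg_right zero_le_one

theorem isBigO_norm_rowOp_pow_mul_one_sub_pinOp (hd : 0 < d) :
    (fun n : ℕ => ‖rowOp (Fin n) (entryProb d n) ^ n * (1 - pinOp (Fin n) (ZMod 2))‖)
      =O[atTop] fun n : ℕ => (n : ℝ) ^ (-(1 / 2) : ℝ) := by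
  have hpin : Tendsto (fun n : ℕ => n * (entryProb d n * (1 - entryProb d n) ^ (n - 1))) atTop
      (𝓝 (d * Real.exp (-d))) := by
    simpa only [mul_assoc] using
      (tendsto_natCast_mul_entryProb d).mul (tendsto_one_sub_entryProb_pow_pred d)
  have hone := tendsto_one_sub_entryProb_pow d
  refine IsBigO.trans (IsBigO.of_norm_eventuallyLE ?_) ((isBigO_one_div_sqrt_mul
    (by positivity) hpin).add (isBigO_one_div_sqrt_mul (Real.exp_pos _) hone))
  filter_upwards [eventually_entryProb_lt_one d, eventually_ne_atTop 0] with n hp1 hn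
  have : NeZero n := ⟨hn⟩
  have hp0 : 0 < entryProb d n := lt_min (by positivity) one_pos
  set T := rowOp (Fin n) (entryProb d n)
  set U := pinOp (Fin n) (ZMod 2)
  have hle := add_le_add (norm_rowOp_pow_mul_sub_pinOp_le (ι := Fin n) hp0 hp1 n)
    (norm_rowOp_pow_mul_sub_one_le (ι := Fin n) hp0.le hp1 n)
  rw [Fintype.card_fin] at hle
  rw [norm_norm]
  calc ‖T ^ n * (1 - U)‖ = ‖T ^ n * (T - U) - T ^ n * (T - 1)‖ := by
        rw [← mul_sub, sub_sub_sub_cancel_left]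
    _ ≤ ‖T ^ n * (T - U)‖ + ‖T ^ n * (T - 1)‖ := norm_sub_le _ _
    _ ≤ _ := hle

theorem isBigO_expect_gap (hd : 0 < d) {ℓ : ℕ} (σ : Fin ℓ → ZMod 2) :
    (fun n : ℕ => if h : ℓ ≤ n then expect d n (gap h σ) else 0)
      =O[atTop] fun n : ℕ => (n : ℝ) ^ (-(1 / 2) : ℝ) := by
  refine IsBigO.trans (IsBigO.of_norm_eventuallyLE ?_)
    ((isBigO_norm_rowOp_pow_mul_one_sub_pinOp hd).const_mul_left (2 ^ ℓ * ℓ ^ 2))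
  filter_upwards [eventually_ge_atTop (2 * ℓ)] with n hn
  have h : ℓ ≤ n := by omega
  rw [dif_pos h, Real.norm_of_nonneg (expect_nonneg hd.le fun _ => gap_nonneg h σ)]
  exact expect_gap_le hd.le h hn σ

end Limits

end SparseParity

theorem proposition2p11_general {γ : ℝ} (hγ : γ < 1 / 2) {d : ℝ} (hd : 0 < d) {ℓ : ℕ}
    (σ : Fin ℓ → ZMod 2) :
    Tendsto
      (fun n : ℕ =>
        if h : ℓ ≤ n then
          SparseParity.expect d n
            (fun A => (n : ℝ) ^ γ * SparseParity.gap h σ A)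
        else 0)
      atTop (𝓝 0) := by
  have hbound := (Asymptotics.isBigO_refl (fun n : ℕ => (n : ℝ) ^ γ) atTop).mul
    (SparseParity.isBigO_expect_gap hd σ)
  have hdecay : Tendsto (fun n : ℕ => (n : ℝ) ^ γ * (n : ℝ) ^ (-(1 / 2) : ℝ)) atTop (𝓝 0) := by
    refine ((tendsto_rpow_neg_atTop (sub_pos.2 hγ)).comp tendsto_natCast_atTop_atTop).congr' ?_
    filter_upwards [eventually_gt_atTop 0] with n hn
    rw [Function.comp_apply, ← Real.rpow_add (by exact_mod_cast hn), neg_sub, sub_eq_add_neg]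
  refine (hbound.trans_tendsto hdecay).congr fun n => ?_
  rw [mul_dite, mul_zero]
  simp only [SparseParity.expect_const_mul]

/-- The first `ℓ` coordinates exist only for `n ≥ ℓ`; the finitely many smaller `n`, for which the
value is set to `0`, do not affect the limit. -/
theorem proposition2p11 (ℓ : ℕ) (hℓ : 1 ≤ ℓ) :
    ∃ γ : ℝ, 0 < γ ∧ ∀ d : ℝ, 0 < d → ∀ σ : Fin ℓ → ZMod 2,
      Tendsto
        (fun n : ℕ =>
          if h : ℓ ≤ n then
            SparseParity.expect d n
              (fun A => (n : ℝ) ^ γ * SparseParity.gap h σ A)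
          else 0)
        atTop (𝓝 0) :=
  ⟨1 / 4, by norm_num, fun _ hd σ => proposition2p11_general (by norm_num) hd σ⟩
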